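/- Let $V$ be a Minkowski plane, i.e. a two-dimensional real normed vector space, with unit disc $B=\{x:\|x\|\le 1\}$ and unit circle $S=\{x:\|x\|=1\}$. Let $\mathrm{Area}$ be any translation-invariant (Lebesgue/Haar) area measure on $V$, and write $\mathrm{Area}(S)$ for the area of the region $B$ enclosed by $S$. Let $\ell(S)$ be the length of $S$ measured in the norm of $V$: if $\gamma:[a,b]\to V$ is any parametrization of $S$ as a simple closed curve (continuous, $\gamma(a)=\gamma(b)$, injective on $[a,b)$, with image $S$), then \[\ell(S)=\sup\Bigl\{\sum_{i=1}^{n}\|\gamma(t_i)-\gamma(t_{i-1})\| : n\ge 1,\ a=t_0<t_1<\dots<t_n=b\Bigr\}.\] Let $P$ be a parallelogram inscribed in $S$ (all four vertices lie on $S$) whose area is maximum among all parallelograms inscribed in $S$. Then $\ell(S)<\infty$ and \[\frac{\mathrm{Area}(S)}{\mathrm{Area}(P)}\le\frac{\ell(S)}{4},\] with equality if and only if $S$ is a Radon curve. Here $S$ is called a Radon curve if normality is symmetric in $V$: for all $x,y\neq 0$, if $\|x\|\le\|x+\lambda y\|$ for all $\lambda\in\mathbf{R}$, then $\|y\|\le\|y+\lambda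 x\|$ for all $\lambda\in\mathbf{R}$. -/

import Mathlib

open MeasureTheory

namespace MinkowskiPlane

/-- `x` is normal (Birkhoff orthogonal) to `y`: both are nonzero and
`‖x‖ ≤ ‖x + c • y‖` for every real `c`. -/
def IsNormal {V : Type*} [NormedAddCommGroup V] [NormedSpace ℝ V] (x y : V) : Prop :=
  x ≠ 0 ∧ y ≠ 0 ∧ ∀ c : ℝ, ‖x‖ ≤ ‖x + c • y‖

/-- The unit circle of `V` is a Radon curve: normality is a symmetric relation. -/
def UnitCircleIsRadon (V : Type*) [NormedAddCommGroup V] [NormedSpace ℝ V] : Prop :=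
  ∀ x y : V, IsNormal x y → IsNormal y x

/-- `P` is a (nondegenerate, solid) parallelogram with vertices `p, q, r, s`, in this cyclic order,
all of which lie on the unit circle. The centre of `P` need not be the origin. -/
def IsInscribedParallelogram {V : Type*} [NormedAddCommGroup V] [NormedSpace ℝ V]
    (P : Set V) : Prop :=
  ∃ p q r s : V,
    p ∈ Metric.sphere (0 : V) 1 ∧ q ∈ Metric.sphere (0 : V) 1 ∧
    r ∈ Metric.sphere (0 : V) 1 ∧ s ∈ Metric.sphere (0 : V) 1 ∧
    p + r = q + s ∧ AffineIndependent ℝ ![p, q, r] ∧ P = convexHull ℝ {p, q, r, s}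

/-- `P` is an inscribed parallelogram of maximum area, area being measured by `μ`. -/
def IsMaxInscribedParallelogram {V : Type*} [NormedAddCommGroup V] [NormedSpace ℝ V]
    [MeasurableSpace V] (μ : Measure V) (P : Set V) : Prop :=
  IsInscribedParallelogram P ∧ ∀ Q : Set V, IsInscribedParallelogram Q → μ Q ≤ μ P

/-- `γ`, restricted to `[a, b]`, is a parametrization of `C` as a simple closed curve. -/
structure IsSimpleClosedParametrization {V : Type*} [NormedAddCommGroup V]
    (γ : ℝ → V) (a b : ℝ) (C : Set V) : Prop where
  lt : a < b
  continuousOn : ContinuousOn γ (Set.Icc a b)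
  closed : γ a = γ b
  injOn : Set.InjOn γ (Set.Ico a b)
  image_eq : γ '' Set.Icc a b = C

/-- The length of the curve `γ` on `[a, b]`: the supremum of the lengths, in the norm of `V`, of
the inscribed polygonal paths. -/
noncomputable def curveLength {V : Type*} [NormedAddCommGroup V]
    (γ : ℝ → V) (a b : ℝ) : ENNReal :=
  eVariationOn γ (Set.Icc a b)

end MinkowskiPlane

/-! Let A be an area form and M = ‖A‖ its operator norm, so that v ↦ ‖A v‖ is a second norm, the
dual norm carried back to V. In units of A an inscribed parallelogram has half the area spanned by
its diagonals, which have norm at most 2; hence the maximum is 2M, attained at ±x, ±y with A(x, y) =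
M. Twice the area of the disc is the integral of `radial` squared (`sector`), so the claim becomes
sector ≤ M · length over one period.

For nearby points u, v of the circle, A(u, v) = A(u, v - u) ≤ ‖A u‖ ‖v - u‖ ≤ M ‖v - u‖, and these
triangles exhaust the sector (`sector_le_mul_eVariationOn`). If equality holds, ‖A u‖ = M on the
whole circle, and then normality is symmetric by `isNormal_iff`.

Conversely, in a Radon plane the two norms have proportional subgradients, so their ratio is
constant (`norm_areaForm_eq_of_radon`). Since the dual norm of any chord is at most its sector
(`norm_areaForm_circ_sub_le`), M · length ≤ sector follows. -/

namespace MinkowskiPlane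

/-! ### The area form, its dual norm, and the Radon property. -/

section AreaForm

variable {V : Type*} [NormedAddCommGroup V] [NormedSpace ℝ V] (e : ℂ ≃L[ℝ] V)

/-- The standard area form of `ℂ`, transported to `V` along `e`. -/
noncomputable def areaForm : V →L[ℝ] V →L[ℝ] ℝ :=
  ((ContinuousLinearMap.compL ℝ ℂ ℂ ℝ Complex.imCLM).comp
    ((ContinuousLinearMap.mul ℝ ℂ).comp (Complex.conjCLE : ℂ →L[ℝ] ℂ))).bilinearComp
      (e.symm : V →L[ℝ] ℂ) (e.symm : V →L[ℝ] ℂ)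

theorem areaForm_apply (x y : V) :
    areaForm e x y = (e.symm x).re * (e.symm y).im - (e.symm x).im * (e.symm y).re := by
  simp [areaForm, Complex.mul_im]
  ring

theorem areaForm_swap (x y : V) : areaForm e x y = -areaForm e y x := by
  simp only [areaForm_apply]; ring

@[simp]
theorem areaForm_self (x : V) : areaForm e x x = 0 := by
  simp only [areaForm_apply]; ring

/-- The Cramer relation between three vectors of a plane. -/
theorem areaForm_smul_eq (x y v : V) :
    areaForm e x y • v = areaForm e v y • x + areaForm e x v • y := by
  apply e.symm.injective
  apply Complex.ext <;>
  · simp [areaForm_apply]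
    ring

theorem areaForm_injective : Function.Injective (areaForm e) := by
  rw [injective_iff_map_eq_zero]
  intro x hx
  have h1 : areaForm e x (e 1) = 0 := by simp [hx]
  have h2 : areaForm e x (e Complex.I) = 0 := by simp [hx]
  simp [areaForm_apply] at h1 h2
  apply e.symm.injective
  apply Complex.ext <;> simp [h1, h2]

theorem norm_areaForm_pos {x : V} (hx : x ≠ 0) : 0 < ‖areaForm e x‖ := by
  rw [norm_pos_iff]
  intro h
  exact hx (areaForm_injective e (by rw [h, map_zero]))

theorem areaForm_norm_pos : 0 < ‖areaForm e‖ := by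
  have h := (norm_areaForm_pos e (x := e 1) (by simp)).trans_le ((areaForm e).le_opNorm _)
  exact pos_of_mul_pos_left h (norm_nonneg _)

/-- A continuous functional on a finite-dimensional space attains its norm. -/
theorem exists_norm_eq_one_apply_eq_norm [FiniteDimensional ℝ V] [Nontrivial V]
    (f : V →L[ℝ] ℝ) : ∃ y : V, ‖y‖ = 1 ∧ f y = ‖f‖ := by
  have : ProperSpace V := FiniteDimensional.proper ℝ V
  obtain ⟨y, hy, hmax⟩ := (isCompact_sphere (0 : V) 1).exists_isMaxOn
    (NormedSpace.sphere_nonempty.mpr zero_le_one) f.continuous.continuousOn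
  have hy1 : ‖y‖ = 1 := by simpa using hy
  refine ⟨y, hy1, le_antisymm ?_ ?_⟩
  · simpa [hy1] using (le_abs_self _).trans (f.le_opNorm y)
  · have key : ∀ v : V, f v ≤ f y * ‖v‖ := by
      intro v
      rcases eq_or_ne v 0 with rfl | hv
      · simp
      · have hv' : 0 < ‖v‖ := norm_pos_iff.mpr hv
        have := hmax (show ‖v‖⁻¹ • v ∈ Metric.sphere (0 : V) 1 by
          simp [norm_smul, hv'.ne'])
        simp only [map_smul, smul_eq_mul, Set.mem_ofPred_eq] at this
        rwa [inv_mul_le_iff₀ hv', mul_comm] at this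
    have h0 : 0 ≤ f y := by
      have := key (-y)
      simp [hy1] at this
      linarith
    refine f.opNorm_le_bound h0 fun v => abs_le.mpr ⟨?_, key v⟩
    have := key (-v)
    simp at this
    linarith

theorem exists_areaForm_eq_norm [FiniteDimensional ℝ V] [Nontrivial V] :
    ∃ x y : V, ‖x‖ = 1 ∧ ‖y‖ = 1 ∧ areaForm e x y = ‖areaForm e‖ := by
  have : ProperSpace V := FiniteDimensional.proper ℝ V
  obtain ⟨x, hx, hmax⟩ := (isCompact_sphere (0 : V) 1).exists_isMaxOn
    (NormedSpace.sphere_nonempty.mpr zero_le_one) (areaForm e).continuous.norm.continuousOn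
  have hx1 : ‖x‖ = 1 := by simpa using hx
  obtain ⟨y, hy, hxy⟩ := exists_norm_eq_one_apply_eq_norm (areaForm e x)
  refine ⟨x, y, hx1, hy, hxy.trans (le_antisymm ?_ ?_)⟩
  · simpa [hx1] using (areaForm e).le_opNorm x
  · refine (areaForm e).opNorm_le_bound (norm_nonneg _) fun v => ?_
    rcases eq_or_ne v 0 with rfl | hv
    · simp
    · have hv' : 0 < ‖v‖ := norm_pos_iff.mpr hv
      have := hmax (show ‖v‖⁻¹ • v ∈ Metric.sphere (0 : V) 1 by simp [norm_smul, hv'.ne'])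
      simp only [map_smul, norm_smul, norm_inv, norm_norm, Set.mem_ofPred_eq] at this
      rwa [inv_mul_le_iff₀ hv', mul_comm] at this

/-- The line x + ℝy is a level set of A(y, ·), so its distance from the origin is |A(x, y)| / ‖A y‖;
normality says that x realises this distance. -/
theorem isNormal_iff [FiniteDimensional ℝ V] [Nontrivial V] {x y : V} (hx : x ≠ 0) (hy : y ≠ 0) :
    IsNormal x y ↔ |areaForm e x y| = ‖areaForm e y‖ * ‖x‖ := by
  have hle : |areaForm e x y| ≤ ‖areaForm e y‖ * ‖x‖ := by
    rw [areaForm_swap, abs_neg]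
    exact (areaForm e y).le_opNorm x
  constructor
  · rintro ⟨-, -, h⟩
    refine le_antisymm hle ?_
    obtain ⟨v, hv, hyv⟩ := exists_norm_eq_one_apply_eq_norm (areaForm e y)
    have hc := areaForm_smul_eq e x y v
    set p := areaForm e v y with hp
    have hpn : p = -‖areaForm e y‖ := by rw [hp, areaForm_swap, hyv]
    have hp0 : p ≠ 0 := by
      rw [hpn]; exact neg_ne_zero.mpr (norm_areaForm_pos e hy).ne'
    -- By the Cramer relation this coefficient moves x along y to a multiple of v, where A(y, ·)
    -- attains its norm.
    have h1 := h (p⁻¹ * areaForm e x v)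
    have h2 : p • (x + (p⁻¹ * areaForm e x v) • y) = areaForm e x y • v := by
      rw [hc, smul_add, smul_smul, mul_inv_cancel_left₀ hp0]
    have h3 : ‖p‖ * ‖x + (p⁻¹ * areaForm e x v) • y‖ = |areaForm e x y| := by
      rw [← norm_smul, h2, norm_smul, hv, mul_one, Real.norm_eq_abs]
    rw [← h3]
    have : ‖p‖ = ‖areaForm e y‖ := by rw [hpn, norm_neg, norm_norm]
    rw [this]
    gcongr
  · intro h
    refine ⟨hx, hy, fun c => ?_⟩
    have h1 := (areaForm e y).le_opNorm (x + c • y)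
    have h2 : areaForm e y (x + c • y) = -areaForm e x y := by
      simp [areaForm_swap e y x]
    rw [h2, norm_neg, Real.norm_eq_abs, h] at h1
    exact le_of_mul_le_mul_left h1 (norm_areaForm_pos e hy)

/-- Under `isNormal_iff`, normality becomes |A(x, y)| = c ‖x‖ ‖y‖, which is symmetric. -/
theorem radon_of_norm_areaForm_eq [FiniteDimensional ℝ V] [Nontrivial V] {c : ℝ}
    (h : ∀ x : V, ‖areaForm e x‖ = c * ‖x‖) : UnitCircleIsRadon V := by
  intro x y hxy
  rw [isNormal_iff e hxy.2.1 hxy.1]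
  rw [isNormal_iff e hxy.1 hxy.2.1] at hxy
  rw [areaForm_swap, abs_neg, hxy, h, h]
  ring

/-- For a Radon curve the norm and its dual norm with respect to the area form have proportional
subgradients. -/
theorem exists_common_subgradient [FiniteDimensional ℝ V] [Nontrivial V]
    (hR : UnitCircleIsRadon V) {v : V} (hv : v ≠ 0) :
    ∃ y : V, areaForm e v y = ‖areaForm e v‖ ∧ (∀ w, areaForm e w y ≤ ‖areaForm e w‖) ∧
      ∀ w, areaForm e w y ≤ ‖areaForm e v‖ / ‖v‖ * ‖w‖ := by
  obtain ⟨y, hy, hvy⟩ := exists_norm_eq_one_apply_eq_norm (areaForm e v)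
  have hy0 : y ≠ 0 := by rintro rfl; simp at hy
  -- Maximality of y makes y normal to v; the Radon property then makes v normal to y, which
  -- determines ‖A y‖ as ‖A v‖ / ‖v‖.
  have h1 : IsNormal y v := by
    rw [isNormal_iff e hy0 hv, areaForm_swap, abs_neg, hvy, hy, mul_one, abs_norm]
  have h2 := (isNormal_iff e hv hy0).mp (hR _ _ h1)
  rw [hvy, abs_norm] at h2
  refine ⟨y, hvy, fun w => ?_, fun w => ?_⟩
  · simpa [hy] using (le_abs_self _).trans ((areaForm e w).le_opNorm y)
  · rw [h2, mul_div_cancel_right₀ _ (norm_ne_zero_iff.mpr hv), areaForm_swap]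
    exact (neg_le_abs _).trans ((areaForm e y).le_opNorm w)

/-- A quotient of two positive functions having proportional subgradients is constant. -/
theorem div_eq_of_common_subgradient {H N s : ℝ → ℝ} {m : ℝ} (hm : 0 < m)
    (hN : ∀ t ∈ Set.Icc (0 : ℝ) 1, m ≤ N t)
    (hH : ∀ t ∈ Set.Icc (0 : ℝ) 1, ∀ u ∈ Set.Icc (0 : ℝ) 1, H t + s t * (u - t) ≤ H u)
    (hHN : ∀ t ∈ Set.Icc (0 : ℝ) 1, ∀ u ∈ Set.Icc (0 : ℝ) 1,
      H t + s t * (u - t) ≤ H t / N t * N u) :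
    H 0 / N 0 = H 1 / N 1 := by
  -- Subgradient inequalities taken at both t and u make the change of H / N second order: an
  -- increment of s times an increment of the variable.
  have step : ∀ t ∈ Set.Icc (0 : ℝ) 1, ∀ u ∈ Set.Icc (0 : ℝ) 1, t ≤ u →
      |H u / N u - H t / N t| ≤ (s u - s t) * ((u - t) / m) := by
    intro t ht u hu htu
    have a1 := hH t ht u hu
    have a2 := hH u hu t ht
    have b1 := hHN t ht u hu
    have b2 := hHN u hu t ht
    have hNt : 0 < N t := hm.trans_le (hN t ht)
    have hNu : 0 < N u := hm.trans_le (hN u hu)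
    have hnn : 0 ≤ (s u - s t) * (u - t) := by nlinarith
    have c1 : H u / N u - H t / N t = (H u - H t / N t * N u) / N u := by field_simp
    have c2 : H t / N t - H u / N u = (H t - H u / N u * N t) / N t := by field_simp
    have d : ∀ X, ∀ n, m ≤ n → X ≤ (s u - s t) * (u - t) →
        X / n ≤ (s u - s t) * ((u - t) / m) := by
      intro X n hn hX
      rw [← mul_div_assoc]
      have : 0 < n := hm.trans_le hn
      calc X / n ≤ (s u - s t) * (u - t) / n := by gcongr
        _ ≤ _ := by gcongr
    rw [abs_le']
    constructor
    · rw [c1]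
      exact d _ _ (hN u hu) (by nlinarith)
    · rw [neg_sub, c2]
      exact d _ _ (hN t ht) (by nlinarith)
  -- Over n equal steps the increments of s telescope, leaving a bound of order 1/n; no regularity
  -- of s is needed.
  have bound : ∀ n : ℕ, 0 < n → |H 1 / N 1 - H 0 / N 0| ≤ (s 1 - s 0) / m * (1 / n) := by
    intro n hn
    have hn' : (0 : ℝ) < n := by exact_mod_cast hn
    have key : ∀ k : ℕ, k ≤ n → |H (k / n) / N (k / n) - H 0 / N 0| ≤
        (s (k / n) - s 0) / m * (1 / n) := by
      intro k
      induction k with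
      | zero => simp
      | succ k ih =>
        intro hk
        have hk1 : (k : ℝ) + 1 ≤ n := by exact_mod_cast hk
        have h1 := ih (by omega)
        have h2 := step (k / n) ⟨by positivity, by rw [div_le_one hn']; linarith⟩
          ((k + 1 : ℕ) / n) ⟨by positivity, by rw [div_le_one hn']; push_cast; linarith⟩
          (by gcongr; simp)
        have h3 : (((k + 1 : ℕ) : ℝ) / n - k / n) = 1 / n := by push_cast; ring
        rw [h3] at h2
        refine (abs_sub_le _ (H (k / n) / N (k / n)) _).trans ((add_le_add h2 h1).trans_eq ?_)
        ring
    simpa [hn'.ne'] using key n le_rfl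
  have hlim : Filter.Tendsto (fun n : ℕ => (s 1 - s 0) / m * (1 / (n : ℝ))) Filter.atTop
      (nhds ((s 1 - s 0) / m * 0)) :=
    tendsto_one_div_atTop_nhds_zero_nat.const_mul _
  have := ge_of_tendsto hlim (Filter.eventually_atTop.mpr ⟨1, fun n hn => bound n hn⟩)
  rw [mul_zero] at this
  have := abs_nonpos_iff.mp this
  linarith

/-- Both norms are restricted to the segment from v to w. Along it A(p t, w - v) is constant and
nonzero, so the segment avoids the origin and ‖p t‖ has a positive lower bound. -/
theorem norm_areaForm_div_norm_eq [FiniteDimensional ℝ V] [Nontrivial V]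
    (hR : UnitCircleIsRadon V) {v w : V} (hvw : areaForm e v w ≠ 0) :
    ‖areaForm e v‖ / ‖v‖ = ‖areaForm e w‖ / ‖w‖ := by
  set p : ℝ → V := fun t => v + t • (w - v) with hp
  have hpw : ∀ t, areaForm e (p t) (w - v) = areaForm e v w := by
    intro t; simp [hp, areaForm_swap e w v]
  have hp0 : ∀ t, p t ≠ 0 := by
    intro t ht
    have := hpw t
    rw [ht] at this
    exact hvw (by simpa using this.symm)
  choose y hy1 hy2 hy3 using fun t => exists_common_subgradient e hR (hp0 t)
  have hpu : ∀ t u, areaForm e (p u) (y t) =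
      ‖areaForm e (p t)‖ + areaForm e (w - v) (y t) * (u - t) := by
    intro t u
    have : p u = p t + (u - t) • (w - v) := by simp only [hp]; module
    rw [this, map_add, map_smul, add_apply, hy1]
    simp [mul_comm]
  have hwv : w - v ≠ 0 := by
    intro h
    have := hpw 0
    rw [h, map_zero] at this
    exact hvw this.symm
  have hC : 0 < ‖areaForm e (w - v)‖ := norm_areaForm_pos e hwv
  have := div_eq_of_common_subgradient (H := fun t => ‖areaForm e (p t)‖) (N := fun t => ‖p t‖)
    (s := fun t => areaForm e (w - v) (y t))
    (m := |areaForm e v w| / ‖areaForm e (w - v)‖) (div_pos (abs_pos.mpr hvw) hC)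
    (fun t _ => by
      rw [div_le_iff₀' hC, ← hpw t, areaForm_swap, abs_neg]
      exact (areaForm e (w - v)).le_opNorm (p t))
    (fun t _ u _ => by rw [← hpu]; exact hy2 t _)
    (fun t _ u _ => by rw [← hpu]; exact hy3 t _)
  simpa [hp] using this

/-- The ratio of the norms is M at both points of a maximising pair x, y, and every nonzero v is
linearly independent of at least one of them. -/
theorem norm_areaForm_eq_of_radon [FiniteDimensional ℝ V] [Nontrivial V]
    (hR : UnitCircleIsRadon V) (v : V) : ‖areaForm e v‖ = ‖areaForm e‖ * ‖v‖ := by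
  obtain ⟨x, y, hx, hy, hxy⟩ := exists_areaForm_eq_norm e
  have hM := areaForm_norm_pos e
  have hxM : ‖areaForm e x‖ = ‖areaForm e‖ := by
    refine le_antisymm (by simpa [hx] using (areaForm e).le_opNorm x) ?_
    have := (areaForm e x).le_opNorm y
    rw [hxy, hy, mul_one] at this
    exact (le_abs_self _).trans this
  have hyM : ‖areaForm e y‖ = ‖areaForm e‖ := by
    refine le_antisymm (by simpa [hy] using (areaForm e).le_opNorm y) ?_
    have := (areaForm e y).le_opNorm x
    rw [areaForm_swap, norm_neg, hxy, hx, mul_one] at this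
    exact (le_abs_self _).trans this
  rcases eq_or_ne v 0 with rfl | hv
  · simp
  have hv' : ‖v‖ ≠ 0 := norm_ne_zero_iff.mpr hv
  by_cases h : areaForm e v x = 0
  · by_cases h' : areaForm e v y = 0
    · exfalso
      have hc := areaForm_smul_eq e x y v
      rw [h', areaForm_swap e x v, h, hxy] at hc
      rw [neg_zero, zero_smul, zero_smul, add_zero, smul_eq_zero] at hc
      exact hc.elim hM.ne' hv
    · have := norm_areaForm_div_norm_eq e hR h'
      rw [hy, div_one, hyM, div_eq_iff hv'] at this
      exact this
  · have := norm_areaForm_div_norm_eq e hR h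
    rw [hx, div_one, hxM, div_eq_iff hv'] at this
    exact this

end AreaForm

/-! ### Sectors and arc length of the unit circle in angular coordinates. -/

section Circ

variable {V : Type*} [NormedAddCommGroup V] [NormedSpace ℝ V] (e : ℂ ≃L[ℝ] V)

/-- The Euclidean radius, in the coordinates `e`, of the unit circle at the angle `θ`. -/
noncomputable def radial (θ : ℝ) : ℝ := ‖e (Complex.exp (θ * Complex.I))‖⁻¹

/-- The parametrization of the unit circle by the angle in the coordinates `e`. -/
noncomputable def circ (θ : ℝ) : V := radial e θ • e (Complex.exp (θ * Complex.I))

/-- Twice the area of the sector of the unit disc between the angles `s` and `t`. -/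
noncomputable def sector (s t : ℝ) : ℝ := ∫ θ in s..t, radial e θ ^ 2

theorem norm_exp_pos (θ : ℝ) : 0 < ‖e (Complex.exp (θ * Complex.I))‖ := by
  simp [Complex.exp_ne_zero]

theorem radial_pos (θ : ℝ) : 0 < radial e θ := inv_pos.mpr (norm_exp_pos e θ)

theorem continuous_radial : Continuous (radial e) :=
  Continuous.inv₀ (by fun_prop) fun θ => (norm_exp_pos e θ).ne'

theorem continuous_circ : Continuous (circ e) :=
  (continuous_radial e).smul (by fun_prop)

@[simp]
theorem norm_circ (θ : ℝ) : ‖circ e θ‖ = 1 := by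
  rw [circ, norm_smul, Real.norm_of_nonneg (radial_pos e θ).le]
  exact inv_mul_cancel₀ (norm_exp_pos e θ).ne'

theorem radial_periodic : Function.Periodic (radial e) (2 * Real.pi) := by
  intro θ
  have : Complex.exp (((θ + 2 * Real.pi : ℝ) : ℂ) * Complex.I)
      = Complex.exp (θ * Complex.I) := by
    push_cast
    rw [add_mul, Complex.exp_add, Complex.exp_two_pi_mul_I, mul_one]
  simp only [radial, this]

theorem circ_periodic : Function.Periodic (circ e) (2 * Real.pi) := by
  intro θ
  have : Complex.exp (((θ + 2 * Real.pi : ℝ) : ℂ) * Complex.I)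
      = Complex.exp (θ * Complex.I) := by
    push_cast
    rw [add_mul, Complex.exp_add, Complex.exp_two_pi_mul_I, mul_one]
  simp only [circ, radial_periodic e θ, this]

theorem circ_eq_of_norm_mul_exp_eq {y : V} (hy : ‖y‖ = 1) {θ : ℝ}
    (h : (‖e.symm y‖ : ℂ) * Complex.exp (θ * Complex.I) = e.symm y) : circ e θ = y := by
  set u := Complex.exp (θ * Complex.I) with hu
  have h2 : y = ‖e.symm y‖ • e u := by
    rw [← map_smul, Complex.real_smul, h, e.apply_symm_apply]
  have h3 : ‖e.symm y‖ = radial e θ := by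
    rw [radial, ← hu]
    refine eq_inv_of_mul_eq_one_left ?_
    rw [← hy]
    conv_rhs => rw [h2]
    rw [norm_smul, norm_norm]
  rw [circ, ← hu, ← h3, ← h2]

theorem exists_circ_eq {y : V} (hy : ‖y‖ = 1) : ∃ θ, circ e θ = y :=
  ⟨_, circ_eq_of_norm_mul_exp_eq e hy (Complex.norm_mul_exp_arg_mul_I (e.symm y))⟩

theorem exists_int_of_circ_eq {s t : ℝ} (h : circ e s = circ e t) :
    ∃ n : ℤ, s = t + n * (2 * Real.pi) := by
  rw [circ, circ, ← map_smul, ← map_smul] at h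
  have h := e.injective h
  have hr : radial e s = radial e t := by
    have := congrArg norm h
    simpa [norm_smul, Complex.norm_exp_ofReal_mul_I, abs_of_pos (radial_pos e _)] using this
  rw [hr] at h
  obtain ⟨n, hn⟩ := Complex.exp_eq_exp_iff_exists_int.mp
    (smul_right_injective ℂ (radial_pos e t).ne' h)
  refine ⟨n, ?_⟩
  have := congrArg Complex.im hn
  simpa using this

theorem exists_circ_eq_mem_Ico {y : V} (hy : ‖y‖ = 1) (α : ℝ) :
    ∃ θ ∈ Set.Ico α (α + 2 * Real.pi), circ e θ = y := by
  obtain ⟨θ, rfl⟩ := exists_circ_eq e hy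
  obtain ⟨ψ, hψ, h⟩ := (circ_periodic e).exists_mem_Ico Real.two_pi_pos θ α
  exact ⟨ψ, hψ, h.symm⟩

theorem areaForm_circ (s t : ℝ) :
    areaForm e (circ e s) (circ e t) = radial e s * radial e t * Real.sin (t - s) := by
  simp [circ, areaForm_apply, Complex.exp_ofReal_mul_I_re, Complex.exp_ofReal_mul_I_im,
    Real.sin_sub]
  ring

/-- Convexity of the unit disc, in terms of inscribed triangles with a vertex at the origin. -/
theorem areaForm_circ_le_add {a b c : ℝ} (hab : a ≤ b) (hbc : b ≤ c)
    (hab' : b - a ≤ Real.pi) (hbc' : c - b ≤ Real.pi) :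
    areaForm e (circ e a) (circ e c) ≤
      areaForm e (circ e a) (circ e b) + areaForm e (circ e b) (circ e c) := by
  simp only [areaForm_circ]
  set E : ℝ → ℂ := fun θ => Complex.exp (θ * Complex.I) with hE
  have hid : Real.sin (c - a) • E b = Real.sin (c - b) • E a + Real.sin (b - a) • E c := by
    apply Complex.ext
    · simp only [hE, Complex.add_re, Complex.smul_re, Complex.exp_ofReal_mul_I_re, smul_eq_mul,
        Real.sin_sub]
      ring
    · simp only [hE, Complex.add_im, Complex.smul_im, Complex.exp_ofReal_mul_I_im, smul_eq_mul,
        Real.sin_sub]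
      ring
  have h1 : 0 ≤ Real.sin (c - b) := Real.sin_nonneg_of_nonneg_of_le_pi (by linarith) hbc'
  have h2 : 0 ≤ Real.sin (b - a) := Real.sin_nonneg_of_nonneg_of_le_pi (by linarith) hab'
  -- The triangle inequality for `hid`; dividing by the three norms gives the claim. The sine on the
  -- left may be negative, since c - a can exceed π.
  have h3 : Real.sin (c - a) * ‖e (E b)‖ ≤
      Real.sin (c - b) * ‖e (E a)‖ + Real.sin (b - a) * ‖e (E c)‖ := by
    calc Real.sin (c - a) * ‖e (E b)‖ ≤ ‖e (Real.sin (c - a) • E b)‖ := by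
          rw [map_smul, norm_smul]
          gcongr
          exact le_abs_self _
      _ ≤ _ := by
          rw [hid, map_add, map_smul, map_smul]
          refine (norm_add_le _ _).trans_eq ?_
          rw [norm_smul, norm_smul, Real.norm_of_nonneg h1, Real.norm_of_nonneg h2]
  have ha := norm_exp_pos e a
  have hb := norm_exp_pos e b
  have hc := norm_exp_pos e c
  simp only [radial]
  simp only [hE] at h3
  have hk := mul_le_mul_of_nonneg_left h3 (inv_pos.mpr (mul_pos (mul_pos ha hb) hc)).le
  refine (le_of_eq ?_).trans (hk.trans (le_of_eq ?_)) <;> field_simp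
  ring

theorem intervalIntegrable_radial_sq (s t : ℝ) :
    IntervalIntegrable (fun θ => radial e θ ^ 2) volume s t :=
  ((continuous_radial e).pow 2).intervalIntegrable _ _

theorem sector_add (a b c : ℝ) : sector e a b + sector e b c = sector e a c :=
  intervalIntegral.integral_add_adjacent_intervals (intervalIntegrable_radial_sq e _ _)
    (intervalIntegrable_radial_sq e _ _)

@[simp]
theorem sector_self (a : ℝ) : sector e a a = 0 := intervalIntegral.integral_same

theorem sector_nonneg {a b : ℝ} (h : a ≤ b) : 0 ≤ sector e a b :=
  intervalIntegral.integral_nonneg h fun _ _ => sq_nonneg _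

/-- Short inscribed triangles approximate the sectors up to an arbitrarily small relative error. -/
theorem exists_abs_areaForm_circ_sub_sector_le (a b : ℝ) {ε : ℝ} (hε : 0 < ε) :
    ∃ δ > 0, ∀ s ∈ Set.Icc a b, ∀ t ∈ Set.Icc a b, s ≤ t → t - s < δ →
      |areaForm e (circ e s) (circ e t) - sector e s t| ≤ ε * (t - s) := by
  obtain ⟨R, hR⟩ := (isCompact_Icc (a := a) (b := b)).exists_bound_of_continuousOn
    (continuous_radial e).continuousOn
  have hunif := (isCompact_Icc (a := a) (b := b)).uniformContinuousOn_of_continuous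
    (continuous_radial e).continuousOn
  have hR' : ∀ x ∈ Set.Icc a b, radial e x ≤ |R| + 1 := fun x hx => by
    have := hR x hx
    rw [Real.norm_of_nonneg (radial_pos e x).le] at this
    have := le_abs_self R
    linarith
  set K := |R| + 1 with hK
  have hK0 : 0 < K := by positivity
  obtain ⟨η, hη, hu⟩ := Metric.uniformContinuousOn_iff.mp hunif (ε / (4 * K)) (by positivity)
  -- The bound η controls the oscillation of the radius, 1 gives |sin d - d| ≤ d², and the last term
  -- makes K² d at most ε / 2.
  refine ⟨min η (min 1 (ε / (2 * K ^ 2))), by positivity, fun s hs t ht hst hδ => ?_⟩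
  have hδ1 := hδ.trans_le (min_le_left _ _)
  have hδ2 := hδ.trans_le ((min_le_right _ _).trans (min_le_left _ _))
  have hδ3 := hδ.trans_le ((min_le_right _ _).trans (min_le_right _ _))
  set d := t - s with hd
  have hd0 : 0 ≤ d := by linarith
  have hrs := radial_pos e s
  have hrt := radial_pos e t
  have hsin : |Real.sin d - d| ≤ d * d := by
    rw [abs_sub_comm, abs_of_nonneg (sub_nonneg.mpr (Real.sin_le hd0))]
    rcases hd0.eq_or_lt with h | h
    · simp [← h]
    · have := Real.sin_gt_sub_cube h
      nlinarith [mul_nonneg hd0 hd0]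
  have h1 : |radial e s * radial e t * Real.sin d - radial e s * radial e t * d| ≤
      ε / 2 * d := by
    rw [← mul_sub, abs_mul, abs_of_pos (mul_pos hrs hrt)]
    calc radial e s * radial e t * |Real.sin d - d| ≤ K * K * (d * d) := by
          gcongr
          · exact hR' s hs
          · exact hR' t ht
      _ = K ^ 2 * d * d := by ring
      _ ≤ ε / 2 * d := by
          gcongr
          rw [lt_div_iff₀ (by positivity)] at hδ3
          linarith
  have h2 : |radial e s * radial e t * d - sector e s t| ≤ ε / 2 * d := by
    have heq : radial e s * radial e t * d - sector e s t =
        ∫ θ in s..t, (radial e s * radial e t - radial e θ ^ 2) := by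
      rw [intervalIntegral.integral_sub (by simp) (intervalIntegrable_radial_sq e _ _),
        intervalIntegral.integral_const, smul_eq_mul, sector]
      ring
    rw [heq, ← Real.norm_eq_abs]
    refine (intervalIntegral.norm_integral_le_of_norm_le_const (C := ε / 2) ?_).trans_eq ?_
    · intro θ hθ
      rw [Set.uIoc_of_le hst] at hθ
      have hθ' : θ ∈ Set.Icc a b := ⟨hs.1.trans hθ.1.le, hθ.2.trans ht.2⟩
      have e1 := hu s hs θ hθ' (by
        rw [Real.dist_eq, abs_sub_comm, abs_of_nonneg] <;> linarith [hθ.1, hθ.2])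
      have e2 := hu t ht θ hθ' (by
        rw [Real.dist_eq, abs_of_nonneg] <;> linarith [hθ.1, hθ.2])
      rw [Real.dist_eq] at e1 e2
      have hrθ := radial_pos e θ
      have heq : radial e s * radial e t - radial e θ ^ 2 =
        radial e s * (radial e t - radial e θ) + radial e θ * (radial e s - radial e θ) := by ring
      rw [heq, Real.norm_eq_abs]
      refine (abs_add_le _ _).trans ?_
      rw [abs_mul, abs_mul, abs_of_pos hrs, abs_of_pos hrθ]
      calc _ ≤ K * (ε / (4 * K)) + K * (ε / (4 * K)) := by
            gcongr
            · exact hR' s hs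
            · exact hR' θ hθ'
        _ = ε / 2 := by field_simp; norm_num
    · rw [abs_of_nonneg hd0]
  rw [areaForm_circ]
  refine (abs_sub_le _ _ _).trans ((add_le_add h1 h2).trans_eq ?_)
  ring

/-- An interval function which is subadditive on an interval, and there bounded above by an
additive one on short intervals up to a small relative error, is bounded above by it. -/
theorem le_of_subadditive_of_locally_le {T I : ℝ → ℝ → ℝ} {a b : ℝ} (hab : a ≤ b)
    (hT0 : T a a ≤ I a a)
    (hT : ∀ s ∈ Set.Icc a b, ∀ t ∈ Set.Icc a b, s ≤ t → T a t ≤ T a s + T s t)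
    (hI : ∀ s ∈ Set.Icc a b, ∀ t ∈ Set.Icc a b, s ≤ t → I a s + I s t ≤ I a t)
    (hloc : ∀ ε > 0, ∃ δ > 0, ∀ s ∈ Set.Icc a b, ∀ t ∈ Set.Icc a b, s ≤ t → t - s < δ →
      T s t ≤ I s t + ε * (t - s)) :
    T a b ≤ I a b := by
  have main : ∀ ε > 0, T a b ≤ I a b + ε * (b - a) := by
    intro ε hε
    obtain ⟨δ, hδ, h⟩ := hloc ε hε
    obtain ⟨n, hn⟩ := exists_nat_gt ((b - a) / δ)
    have hba : 0 ≤ b - a := sub_nonneg.mpr hab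
    have hn0 : (0 : ℝ) < n := (div_nonneg hba hδ.le).trans_lt hn
    have hd : (b - a) / n < δ := by
      rw [div_lt_iff₀ hδ] at hn
      rw [div_lt_iff₀ hn0]
      linarith
    set d := (b - a) / n with hdd
    have hd0 : 0 ≤ d := by positivity
    have hnd : n * d = b - a := by rw [hdd]; field_simp
    have hmem : ∀ k : ℕ, k ≤ n → a + k * d ∈ Set.Icc a b := by
      intro k hk
      have : (k : ℝ) * d ≤ n * d := by gcongr
      exact ⟨by nlinarith [mul_nonneg (Nat.cast_nonneg (α := ℝ) k) hd0], by linarith⟩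
    have key : ∀ k : ℕ, k ≤ n → T a (a + k * d) ≤ I a (a + k * d) + ε * (k * d) := by
      intro k
      induction k with
      | zero => simpa using hT0
      | succ k ih =>
        intro hk
        have h0 := ih (by omega)
        have m1 := hmem k (by omega)
        have m2 := hmem (k + 1) hk
        have hle : a + k * d ≤ a + (k + 1 : ℕ) * d := by push_cast; linarith
        have hsub : a + (k + 1 : ℕ) * d - (a + k * d) = d := by push_cast; ring
        have h1 := h _ m1 _ m2 hle (by rwa [hsub])
        rw [hsub] at h1
        have h2 := hT _ m1 _ m2 hle
        have h3 := hI _ m1 _ m2 hle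
        have h4 : ε * (((k + 1 : ℕ) : ℝ) * d) = ε * (k * d) + ε * d := by push_cast; ring
        linarith
    have := key n le_rfl
    rw [hnd] at this
    simpa using this
  have hlim : Filter.Tendsto (fun ε : ℝ => I a b + ε * (b - a)) (nhdsWithin 0 (Set.Ioi 0))
      (nhds (I a b + 0 * (b - a))) :=
    ((continuous_const.add (continuous_id.mul continuous_const)).tendsto _).mono_left
      nhdsWithin_le_nhds
  have := ge_of_tendsto hlim (Filter.eventually_of_mem self_mem_nhdsWithin fun ε hε => main ε hε)
  simpa using this

/-- An inscribed triangle with a vertex at the origin lies in the corresponding sector. -/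
theorem areaForm_circ_le_sector {s t : ℝ} (hst : s ≤ t) (hst' : t - s ≤ Real.pi) :
    areaForm e (circ e s) (circ e t) ≤ sector e s t := by
  refine le_of_subadditive_of_locally_le (T := fun s t => areaForm e (circ e s) (circ e t))
    (I := sector e) hst (by simp) (fun u hu v hv huv => ?_)
    (fun u _ v _ _ => (sector_add e _ _ _).le) (fun ε hε => ?_)
  · exact areaForm_circ_le_add e hu.1 huv (by linarith [hu.2]) (by linarith [hu.1, hv.2])
  · obtain ⟨δ, hδ, h⟩ := exists_abs_areaForm_circ_sub_sector_le e s t hε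
    refine ⟨δ, hδ, fun u hu v hv huv huv' => ?_⟩
    have := (abs_le.mp (h u hu v hv huv huv')).2
    linarith

/-- The norm is attained at some `circ e ψ`, with value A(s, ψ) + A(ψ, t) at the corresponding
points. For ψ in [s, t] these are two triangles inside the sector; otherwise convexity bounds the
sum by A(s, t). -/
theorem norm_areaForm_circ_sub_le_of_le_pi [FiniteDimensional ℝ V] [Nontrivial V] {s t : ℝ}
    (hst : s ≤ t) (hst' : t - s ≤ Real.pi) :
    ‖areaForm e (circ e t - circ e s)‖ ≤ sector e s t := by
  obtain ⟨y, hy, hmax⟩ := exists_norm_eq_one_apply_eq_norm (areaForm e (-(circ e t - circ e s)))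
  rw [map_neg, norm_neg, ← map_neg] at hmax
  rw [← hmax]
  obtain ⟨ψ, hψ, rfl⟩ := exists_circ_eq_mem_Ico e hy s
  have hexp : areaForm e (-(circ e t - circ e s)) (circ e ψ) =
      areaForm e (circ e s) (circ e ψ) + areaForm e (circ e ψ) (circ e t) := by
    rw [areaForm_swap e (circ e ψ) (circ e t)]
    simp [sub_eq_add_neg]
  rw [hexp]
  have hT := areaForm_circ_le_sector e hst hst'
  rcases le_total ψ t with h1 | h1
  · rw [← sector_add e s ψ t]
    exact add_le_add (areaForm_circ_le_sector e hψ.1 (by linarith))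
      (areaForm_circ_le_sector e h1 (by linarith [hψ.1]))
  · rcases le_total (ψ - t) Real.pi with h2 | h2
    · have := areaForm_circ_le_add e hst h1 hst' h2
      rw [areaForm_swap e (circ e ψ)]
      linarith
    · rw [← (circ_periodic e).sub_eq ψ]
      have h3 := hψ.2
      have := areaForm_circ_le_add e (a := ψ - 2 * Real.pi) (b := s) (c := t) (by linarith) hst
        (by linarith) hst'
      rw [areaForm_swap e (circ e s)]
      linarith

/-- The restriction to angles up to π disappears by subdivision, the left side being subadditive. -/
theorem norm_areaForm_circ_sub_le [FiniteDimensional ℝ V] [Nontrivial V] {s t : ℝ}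
    (hst : s ≤ t) : ‖areaForm e (circ e t - circ e s)‖ ≤ sector e s t := by
  refine le_of_subadditive_of_locally_le
    (T := fun s t => ‖areaForm e (circ e t - circ e s)‖)
    (I := sector e) hst (by simp) (fun u hu v hv huv => ?_)
    (fun u _ v _ _ => (sector_add e _ _ _).le) (fun ε hε => ⟨Real.pi, Real.pi_pos, ?_⟩)
  · have : circ e v - circ e s = (circ e u - circ e s) + (circ e v - circ e u) := by abel
    simp only [this, map_add]
    exact norm_add_le _ _
  · intro u _ v _ huv huv'
    have := norm_areaForm_circ_sub_le_of_le_pi e huv huv'.le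
    have := mul_nonneg hε.le (sub_nonneg.mpr huv)
    linarith

/-- Serves twice: some K gives finite length, and K = 1/M gives the reverse inequality in a Radon
plane. -/
theorem eVariationOn_circ_le [FiniteDimensional ℝ V] [Nontrivial V] {K : ℝ} (hK0 : 0 ≤ K)
    (hK : ∀ v, ‖v‖ ≤ K * ‖areaForm e v‖) (s t : ℝ) :
    eVariationOn (circ e) (Set.Icc s t) ≤ ENNReal.ofReal (K * sector e s t) := by
  refine iSup_le ?_
  rintro ⟨n, u, hu, hmem⟩
  have h1 : ∀ i, edist (circ e (u (i + 1))) (circ e (u i)) ≤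
      ENNReal.ofReal (K * sector e (u i) (u (i + 1))) := by
    intro i
    rw [edist_dist, dist_eq_norm]
    refine ENNReal.ofReal_le_ofReal ((hK _).trans ?_)
    gcongr
    exact norm_areaForm_circ_sub_le e (hu (Nat.le_succ i))
  refine (Finset.sum_le_sum fun i _ => h1 i).trans ?_
  rw [← ENNReal.ofReal_sum_of_nonneg fun i _ =>
    mul_nonneg hK0 (sector_nonneg e (hu (Nat.le_succ i)))]
  refine ENNReal.ofReal_le_ofReal ?_
  rw [← Finset.mul_sum]
  gcongr
  have h2 : ∀ n : ℕ, ∑ i ∈ Finset.range n, sector e (u i) (u (i + 1)) = sector e (u 0) (u n) := by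
    intro n
    induction n with
    | zero => simp
    | succ n ih => rw [Finset.sum_range_succ, ih, sector_add]
  rw [h2, ← sector_add e s (u 0) t, ← sector_add e (u 0) (u n) t]
  have := sector_nonneg e (hmem 0).1
  have := sector_nonneg e (hmem n).2
  linarith

theorem eVariationOn_circ_ne_top [FiniteDimensional ℝ V] [Nontrivial V] (s t : ℝ) :
    eVariationOn (circ e) (Set.Icc s t) ≠ ⊤ := by
  obtain ⟨K, -, hK⟩ := (areaForm e : V →ₗ[ℝ] V →L[ℝ] ℝ).exists_antilipschitzWith
    (LinearMap.ker_eq_bot.mpr (areaForm_injective e))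
  refine ne_top_of_le_ne_top ENNReal.ofReal_ne_top
    (eVariationOn_circ_le e K.coe_nonneg (fun v => ?_) s t)
  simpa using hK.le_mul_norm_sub (x := v) (y := 0)

theorem toReal_eVariationOn_circ_add [FiniteDimensional ℝ V] [Nontrivial V] {a b c : ℝ}
    (hab : a ≤ b) (hbc : b ≤ c) :
    (eVariationOn (circ e) (Set.Icc a b)).toReal + (eVariationOn (circ e) (Set.Icc b c)).toReal =
      (eVariationOn (circ e) (Set.Icc a c)).toReal := by
  rw [← ENNReal.toReal_add (eVariationOn_circ_ne_top e _ _) (eVariationOn_circ_ne_top e _ _)]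
  have := eVariationOn.Icc_add_Icc (circ e) (s := Set.univ) hab hbc (Set.mem_univ _)
  simp only [Set.univ_inter] at this
  rw [this]

theorem norm_circ_sub_le_toReal_eVariationOn [FiniteDimensional ℝ V] [Nontrivial V] {a b : ℝ}
    (hab : a ≤ b) :
    ‖circ e b - circ e a‖ ≤ (eVariationOn (circ e) (Set.Icc a b)).toReal := by
  rw [← dist_eq_norm, dist_edist]
  exact ENNReal.toReal_mono (eVariationOn_circ_ne_top e _ _)
    (eVariationOn.edist_le _ (Set.right_mem_Icc.mpr hab) (Set.left_mem_Icc.mpr hab))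

/-- The area of a sector is bounded in terms of its arc length. -/
theorem sector_le_mul_eVariationOn [FiniteDimensional ℝ V] [Nontrivial V] {K s t : ℝ}
    (hK0 : 0 ≤ K) (hst : s ≤ t)
    (hK : ∀ θ ∈ Set.Icc s t, ‖areaForm e (circ e θ)‖ ≤ K) :
    sector e s t ≤ K * (eVariationOn (circ e) (Set.Icc s t)).toReal := by
  refine le_of_subadditive_of_locally_le (T := sector e)
    (I := fun s t => K * (eVariationOn (circ e) (Set.Icc s t)).toReal) hst
    (by simp [eVariationOn.subsingleton]) (fun u _ v _ _ => (sector_add e _ _ _).ge)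
    (fun u hu v hv huv => ?_) (fun ε hε => ?_)
  · rw [← mul_add, toReal_eVariationOn_circ_add e hu.1 huv]
  · obtain ⟨δ, hδ, h⟩ := exists_abs_areaForm_circ_sub_sector_le e s t hε
    refine ⟨δ, hδ, fun u hu v hv huv huv' => ?_⟩
    have h1 := (abs_le.mp (h u hu v hv huv huv')).1
    have h2 : areaForm e (circ e u) (circ e v) ≤
        K * (eVariationOn (circ e) (Set.Icc u v)).toReal := by
      -- Replacing the second point by the chord, as A(u, u) = 0, turns area into length.
      have : areaForm e (circ e u) (circ e v) = areaForm e (circ e u) (circ e v - circ e u) := by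
        simp
      rw [this]
      refine (le_abs_self _).trans (((areaForm e (circ e u)).le_opNorm _).trans ?_)
      gcongr
      · exact hK u hu
      · exact norm_circ_sub_le_toReal_eVariationOn e huv
    linarith

theorem norm_areaForm_circ_le (θ : ℝ) : ‖areaForm e (circ e θ)‖ ≤ ‖areaForm e‖ := by
  simpa using (areaForm e).le_opNorm (circ e θ)

theorem circ_ne_of_sub_lt_pi {s t : ℝ} (hst : s < t) (hst' : t - s < Real.pi) :
    circ e s ≠ circ e t := by
  intro h
  have := areaForm_circ e s t
  rw [h, areaForm_self] at this
  have h1 := radial_pos e s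
  have h2 := radial_pos e t
  have h3 := Real.sin_pos_of_pos_of_lt_pi (sub_pos.mpr hst) hst'
  have := mul_pos (mul_pos h1 h2) h3
  linarith

theorem sector_period_le [FiniteDimensional ℝ V] [Nontrivial V] (α : ℝ) :
    sector e α (α + 2 * Real.pi) ≤
      ‖areaForm e‖ * (eVariationOn (circ e) (Set.Icc α (α + 2 * Real.pi))).toReal :=
  sector_le_mul_eVariationOn e (norm_nonneg (areaForm e)) (by linarith [Real.pi_pos])
    fun θ _ => norm_areaForm_circ_le e θ

/-- Equality in the comparison of area and length forces the dual norm of every unit vector to be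
maximal. -/
theorem norm_areaForm_eq_of_sector_period_eq [FiniteDimensional ℝ V] [Nontrivial V] {α : ℝ}
    (h : sector e α (α + 2 * Real.pi) =
      ‖areaForm e‖ * (eVariationOn (circ e) (Set.Icc α (α + 2 * Real.pi))).toReal) (x : V) :
    ‖areaForm e x‖ = ‖areaForm e‖ * ‖x‖ := by
  have hM := areaForm_norm_pos e
  have main : ∀ θ ∈ Set.Ico α (α + 2 * Real.pi), ‖areaForm e (circ e θ)‖ = ‖areaForm e‖ := by
    intro θ hθ
    by_contra hne
    have hlt := (norm_areaForm_circ_le e θ).lt_of_ne hne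
    obtain ⟨K, hK1, hK2⟩ := exists_between hlt
    have hcont : Continuous fun θ => ‖areaForm e (circ e θ)‖ :=
      ((areaForm e).continuous.comp (continuous_circ e)).norm
    obtain ⟨δ, hδ, hball⟩ := Metric.eventually_nhds_iff.mp
      (hcont.continuousAt.eventually_lt continuousAt_const hK1)
    -- On the arc [θ, θ + η] the dual norm stays below K < M. The bound π / 2 makes its endpoints
    -- distinct, hence its length positive; the last bound keeps it within the period. The strict
    -- loss there contradicts equality.
    set η := min (δ / 2) (min (Real.pi / 2) (α + 2 * Real.pi - θ)) with hη
    have hη0 : 0 < η := by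
      have := Real.pi_pos
      have := hθ.2
      refine lt_min (by linarith) (lt_min (by linarith) (by linarith))
    have hη1 : η ≤ δ / 2 := min_le_left _ _
    have hη2 : η ≤ Real.pi / 2 := (min_le_right _ _).trans (min_le_left _ _)
    have hη3 : η ≤ α + 2 * Real.pi - θ := (min_le_right _ _).trans (min_le_right _ _)
    have hle1 : θ ≤ θ + η := by linarith
    have hle2 : θ + η ≤ α + 2 * Real.pi := by linarith
    have b1 := sector_le_mul_eVariationOn e (norm_nonneg (areaForm e)) hθ.1
      fun φ _ => norm_areaForm_circ_le e φ
    have b2 := sector_le_mul_eVariationOn e (K := K) ((norm_nonneg _).trans hK1.le) hle1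
      fun φ hφ => (hball (by
        rw [Real.dist_eq, abs_of_nonneg] <;> linarith [hφ.1, hφ.2])).le
    have b3 := sector_le_mul_eVariationOn e (norm_nonneg (areaForm e)) hle2
      fun φ _ => norm_areaForm_circ_le e φ
    have hpos : 0 < (eVariationOn (circ e) (Set.Icc θ (θ + η))).toReal := by
      refine lt_of_lt_of_le ?_ (norm_circ_sub_le_toReal_eVariationOn e hle1)
      rw [norm_pos_iff, sub_ne_zero]
      exact (circ_ne_of_sub_lt_pi e (by linarith) (by linarith [Real.pi_pos])).symm
    rw [← toReal_eVariationOn_circ_add e hθ.1 (hle1.trans hle2),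
      ← toReal_eVariationOn_circ_add e hle1 hle2, ← sector_add e α θ,
      ← sector_add e θ (θ + η)] at h
    have := mul_lt_mul_of_pos_right hK2 hpos
    rw [mul_add, mul_add] at h
    linarith
  rcases eq_or_ne x 0 with rfl | hx
  · simp
  have hx' : ‖x‖ ≠ 0 := norm_ne_zero_iff.mpr hx
  obtain ⟨θ, hθ, hθx⟩ := exists_circ_eq_mem_Ico e (y := ‖x‖⁻¹ • x)
    (by rw [norm_smul, norm_inv, norm_norm, inv_mul_cancel₀ hx']) α
  have := main θ hθ
  rw [hθx, map_smul, norm_smul, norm_inv, norm_norm, inv_mul_eq_iff_eq_mul₀ hx'] at this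
  rw [this, mul_comm]

theorem sector_period_eq_iff_radon [FiniteDimensional ℝ V] [Nontrivial V] (α : ℝ) :
    sector e α (α + 2 * Real.pi) =
      ‖areaForm e‖ * (eVariationOn (circ e) (Set.Icc α (α + 2 * Real.pi))).toReal ↔
        UnitCircleIsRadon V := by
  refine ⟨fun h => radon_of_norm_areaForm_eq e (norm_areaForm_eq_of_sector_period_eq e h),
    fun hR => le_antisymm (sector_period_le e α) ?_⟩
  have hM := areaForm_norm_pos e
  have hα : α ≤ α + 2 * Real.pi := by linarith [Real.pi_pos]
  have h := eVariationOn_circ_le e (K := ‖areaForm e‖⁻¹) (inv_nonneg.mpr hM.le)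
    (fun v => by rw [norm_areaForm_eq_of_radon e hR, inv_mul_cancel_left₀ hM.ne']) α (α + 2 * Real.pi)
  have h' := ENNReal.toReal_mono ENNReal.ofReal_ne_top h
  rw [ENNReal.toReal_ofReal (mul_nonneg (inv_nonneg.mpr hM.le) (sector_nonneg e hα)),
    le_inv_mul_iff₀ hM] at h'
  exact h'

end Circ

/-! ### Reduction of an arbitrary simple closed parametrization to the angular one. -/

section Parametrization

variable {V : Type*} [NormedAddCommGroup V] [NormedSpace ℝ V] (e : ℂ ≃L[ℝ] V)

/-- The curve, extended by constants to ℝ, lifts through the covering `Complex.exp` of the punctured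
plane; the imaginary part of the lift is the angle. -/
theorem exists_continuous_circ_eq {γ : ℝ → V} {a b : ℝ} (hab : a ≤ b)
    (hγ : ContinuousOn γ (Set.Icc a b)) (h1 : ∀ t ∈ Set.Icc a b, ‖γ t‖ = 1) :
    ∃ Θ : ℝ → ℝ, Continuous Θ ∧ ∀ t ∈ Set.Icc a b, circ e (Θ t) = γ t := by
  set g : ℝ → V := Set.IccExtend hab ((Set.Icc a b).domRestrict γ) with hg
  have hgc : Continuous g := hγ.domRestrict.Icc_extend'
  have hg1 : ∀ t, ‖g t‖ = 1 := fun t => h1 _ (Set.projIcc a b hab t).2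
  have hg0 : ∀ t, e.symm (g t) ≠ 0 := by
    intro t ht
    have := hg1 t
    rw [e.symm.map_eq_zero_iff.mp ht] at this
    simp at this
  obtain ⟨L, ⟨-, hL⟩, -⟩ := Complex.isCoveringMap_exp.existsUnique_continuousMap_lifts
    (A := ℝ) ⟨fun t => (⟨e.symm (g t), hg0 t⟩ : {z : ℂ // z ≠ 0}),
      Continuous.subtype_mk (by fun_prop) _⟩ a (Complex.log (e.symm (g a)))
    (Subtype.ext (Complex.exp_log (hg0 a)))
  have hexp : ∀ t, Complex.exp (L t) = e.symm (g t) := fun t =>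
    congrArg Subtype.val (congrFun hL t)
  refine ⟨fun t => (L t).im, Complex.continuous_im.comp L.continuous, fun t ht => ?_⟩
  have hgt : g t = γ t := by
    rw [hg, Set.IccExtend_of_mem hab _ ht]
    rfl
  rw [← hgt]
  refine circ_eq_of_norm_mul_exp_eq e (hg1 t) ?_
  rw [← hexp t, Complex.norm_exp, Complex.ofReal_exp, ← Complex.exp_add, Complex.re_add_im]

/-- Limits from inside give weak monotonicity up to the endpoints; two interior points between x and
y restore strictness. -/
theorem strictMonoOn_Icc_of_Ioo {Θ : ℝ → ℝ} {a b : ℝ} (hab : a < b)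
    (hc : ContinuousOn Θ (Set.Icc a b)) (h : StrictMonoOn Θ (Set.Ioo a b)) :
    StrictMonoOn Θ (Set.Icc a b) := by
  have hmono : MonotoneOn Θ (Set.Icc a b) := by
    have := h.monotoneOn
    intro x hx y hy hxy
    rcases hxy.eq_or_lt with rfl | hxy
    · rfl
    have hconv : ∀ z ∈ Set.Icc a b, Filter.Tendsto (fun ε : ℝ => Θ (z + ε * ((a + b) / 2 - z)))
        (nhdsWithin 0 (Set.Ioo 0 1)) (nhds (Θ z)) := by
      intro z hz
      have h1 : Filter.Tendsto (fun ε : ℝ => z + ε * ((a + b) / 2 - z))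
          (nhdsWithin 0 (Set.Ioo 0 1)) (nhds z) := by
        have : Continuous fun ε : ℝ => z + ε * ((a + b) / 2 - z) := by fun_prop
        simpa using (this.tendsto 0).mono_left nhdsWithin_le_nhds
      refine (hc z hz).tendsto.comp (tendsto_nhdsWithin_iff.mpr ⟨h1, ?_⟩)
      filter_upwards [self_mem_nhdsWithin] with ε hε
      constructor <;> nlinarith [hz.1, hz.2, hε.1, hε.2]
    have hne : (nhdsWithin (0 : ℝ) (Set.Ioo 0 1)).NeBot := by
      rw [← mem_closure_iff_nhdsWithin_neBot, closure_Ioo zero_ne_one]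
      simp
    refine le_of_tendsto_of_tendsto (hconv x hx) (hconv y hy) ?_
    filter_upwards [self_mem_nhdsWithin] with ε hε
    have hmem : ∀ z ∈ Set.Icc a b, z + ε * ((a + b) / 2 - z) ∈ Set.Ioo a b := by
      intro z hz
      constructor <;> nlinarith [hz.1, hz.2, hε.1, hε.2]
    exact this (hmem x hx) (hmem y hy) (by nlinarith [hε.1, hε.2])
  intro x hx y hy hxy
  have m1 : (2 * x + y) / 3 ∈ Set.Ioo a b := ⟨by linarith [hx.1], by linarith [hy.2]⟩
  have m2 : (x + 2 * y) / 3 ∈ Set.Ioo a b := ⟨by linarith [hx.1], by linarith [hy.2]⟩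
  have := hmono hx ⟨m1.1.le, m1.2.le⟩ (by linarith)
  have := hmono ⟨m2.1.le, m2.2.le⟩ hy (by linarith)
  have := h m1 m2 (by linarith)
  linarith

/-- The total increase is a positive multiple of p; if it exceeded p, the intermediate value theorem
would give an interior point where Θ equals Θ a + p. -/
theorem eq_add_of_strictMonoOn {Θ : ℝ → ℝ} {a b p : ℝ} (hab : a < b) (hp : 0 < p)
    (hc : ContinuousOn Θ (Set.Icc a b)) (h : StrictMonoOn Θ (Set.Icc a b))
    (hb : ∃ n : ℤ, Θ b = Θ a + n * p)
    (hne : ∀ t ∈ Set.Ioo a b, ∀ n : ℤ, Θ t ≠ Θ a + n * p) :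
    Θ b = Θ a + p := by
  obtain ⟨n, hn⟩ := hb
  have hlt := h (Set.left_mem_Icc.mpr hab.le) (Set.right_mem_Icc.mpr hab.le) hab
  have hn0 : 0 < n := by
    by_contra hn0
    have : (n : ℝ) ≤ 0 := by exact_mod_cast not_lt.mp hn0
    nlinarith
  rcases (show 1 ≤ n from hn0).eq_or_lt with rfl | hn1
  · simpa using hn
  · exfalso
    have hn1' : (1 : ℝ) < n := by exact_mod_cast hn1
    obtain ⟨t, ht, hte⟩ := intermediate_value_Ioo hab.le hc
      (show Θ a + p ∈ Set.Ioo (Θ a) (Θ b) from ⟨by linarith, by nlinarith⟩)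
    exact hne t ht 1 (by simpa using hte)

/-- The length of the unit circle does not depend on the parametrization. -/
theorem exists_curveLength_eq {γ : ℝ → V} {a b : ℝ}
    (hγ : IsSimpleClosedParametrization γ a b (Metric.sphere (0 : V) 1)) :
    ∃ α : ℝ, curveLength γ a b = eVariationOn (circ e) (Set.Icc α (α + 2 * Real.pi)) := by
  have hab := hγ.lt
  have h1 : ∀ t ∈ Set.Icc a b, ‖γ t‖ = 1 := by
    intro t ht
    have : γ t ∈ Metric.sphere (0 : V) 1 := hγ.image_eq ▸ Set.mem_image_of_mem γ ht
    simpa using this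
  obtain ⟨Θ, hΘ, hcirc⟩ := exists_continuous_circ_eq e hab.le hγ.continuousOn h1
  have hend : ∃ n : ℤ, Θ b = Θ a + n * (2 * Real.pi) := by
    refine exists_int_of_circ_eq e ?_
    rw [hcirc _ (Set.right_mem_Icc.mpr hab.le), hcirc _ (Set.left_mem_Icc.mpr hab.le), hγ.closed]
  have hne : ∀ t ∈ Set.Ioo a b, ∀ n : ℤ, Θ t ≠ Θ a + n * (2 * Real.pi) := by
    intro t ht n hn
    have : γ t = γ a := by
      rw [← hcirc t ⟨ht.1.le, ht.2.le⟩, ← hcirc a (Set.left_mem_Icc.mpr hab.le), hn]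
      exact (circ_periodic e).int_mul n _
    exact ht.1.ne' (hγ.injOn ⟨ht.1.le, ht.2⟩ (Set.left_mem_Ico.mpr hab) this)
  have hinj : Set.InjOn Θ (Set.Ioo a b) := by
    intro s hs t ht hst
    refine hγ.injOn ⟨hs.1.le, hs.2⟩ ⟨ht.1.le, ht.2⟩ ?_
    rw [← hcirc s ⟨hs.1.le, hs.2.le⟩, ← hcirc t ⟨ht.1.le, ht.2.le⟩, hst]
  have hlen : curveLength γ a b = eVariationOn (circ e ∘ Θ) (Set.Icc a b) :=
    eVariationOn.congr fun t ht => (hcirc t ht).symm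
  rw [hlen]
  rcases ContinuousOn.strictMonoOn_of_injOn_Ioo hab hΘ.continuousOn hinj with hm | hm
  · have hm' := strictMonoOn_Icc_of_Ioo hab hΘ.continuousOn hm
    have hb := eq_add_of_strictMonoOn hab Real.two_pi_pos hΘ.continuousOn hm' hend hne
    refine ⟨Θ a, ?_⟩
    rw [eVariationOn.comp_eq_of_monotoneOn _ _ hm'.monotoneOn,
      hΘ.continuousOn.image_Icc_of_monotoneOn hab.le hm'.monotoneOn, hb]
  -- A clockwise curve: the winding is computed for -Θ, and the variation is insensitive to
  -- reversal.
  · have hm' := strictMonoOn_Icc_of_Ioo (Θ := fun t => -Θ t) hab hΘ.neg.continuousOn hm.neg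
    have hb : -Θ b = -Θ a + 2 * Real.pi := by
      obtain ⟨n, hn⟩ := hend
      refine eq_add_of_strictMonoOn (Θ := fun t => -Θ t) hab Real.two_pi_pos
        hΘ.neg.continuousOn hm' ⟨-n, ?_⟩ fun t ht n hn => hne t ht (-n) ?_
      · simp only [hn]
        push_cast
        ring
      · push_cast
        linarith
    have hanti : AntitoneOn Θ (Set.Icc a b) := fun x hx y hy hxy =>
      neg_le_neg_iff.mp (hm'.monotoneOn hx hy hxy)
    refine ⟨Θ b, ?_⟩
    rw [eVariationOn.comp_eq_of_antitoneOn _ _ hanti,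
      hΘ.continuousOn.image_Icc_of_antitoneOn hab.le hanti]
    congr 2
    linarith

end Parametrization

/-! ### Haar measure, the unit disc and parallelograms in coordinates. -/

section Area

variable {V : Type*} [NormedAddCommGroup V] [NormedSpace ℝ V] (e : ℂ ≃L[ℝ] V)

theorem exists_measureReal_eq [MeasurableSpace V] [BorelSpace V] (μ : Measure V)
    [μ.IsAddHaarMeasure] :
    ∃ k : ℝ, 0 < k ∧ ∀ s : Set V, μ.real s = k * (volume : Measure ℂ).real (e ⁻¹' s) := by
  have hν : (μ.map e.symm).IsAddHaarMeasure := e.symm.isAddHaarMeasure_map μ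
  have h := Measure.isAddLeftInvariant_eq_smul (μ.map e.symm) (volume : Measure ℂ)
  refine ⟨(μ.map e.symm).addHaarScalarFactor volume,
    by exact_mod_cast Measure.addHaarScalarFactor_pos_of_isAddHaarMeasure _ _, fun s => ?_⟩
  have h1 : μ s = μ.map e.symm (e ⁻¹' s) := by
    have := e.symm.toHomeomorph.toMeasurableEquiv.map_apply (μ := μ) (e ⁻¹' s)
    refine Eq.trans ?_ this.symm
    congr 1
    ext x
    simp
  rw [measureReal_def, h1]
  refine (congrArg ENNReal.toReal (DFunLike.congr_fun h (e ⁻¹' s))).trans ?_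
  simp [measureReal_def]

/-- In polar coordinates the disc is 0 < r ≤ `radial e θ`, and the inner integral of r dr is half
the square of the radius. -/
theorem volume_real_unitDisc :
    (volume : Measure ℂ).real (e ⁻¹' Metric.closedBall 0 1) =
      sector e (-Real.pi) Real.pi / 2 := by
  have hmeas : MeasurableSet (e ⁻¹' Metric.closedBall (0 : V) 1) :=
    (Metric.isClosed_closedBall.preimage e.continuous).measurableSet
  have hvol : volume (e ⁻¹' Metric.closedBall (0 : V) 1) =
      ENNReal.ofReal (sector e (-Real.pi) Real.pi / 2) := by
    rw [← lintegral_indicator_one hmeas, ← Complex.lintegral_comp_polarCoord_symm]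
    have hset : ∀ p : ℝ × ℝ, p ∈ polarCoord.target →
        (ENNReal.ofReal p.1 • (e ⁻¹' Metric.closedBall (0 : V) 1).indicator
          (1 : ℂ → ENNReal) (Complex.polarCoord.symm p)) =
        (Set.Ioc 0 (radial e p.2)).indicator (fun r => ENNReal.ofReal r) p.1 := by
      rintro ⟨r, θ⟩ hp
      have hr : 0 < r := by
        rw [polarCoord_target] at hp
        exact hp.1
      have hpol : Complex.polarCoord.symm (r, θ) = r • Complex.exp (θ * Complex.I) := by
        rw [Complex.polarCoord_symm_apply, Complex.exp_mul_I, Complex.real_smul]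
        simp
      have hiff : Complex.polarCoord.symm (r, θ) ∈ e ⁻¹' Metric.closedBall (0 : V) 1 ↔
          r ∈ Set.Ioc 0 (radial e θ) := by
        rw [hpol, Set.mem_preimage, mem_closedBall_zero_iff, map_smul, norm_smul,
          Real.norm_of_nonneg hr.le, ← le_div_iff₀ (norm_exp_pos e θ), one_div]
        exact ⟨fun h => ⟨hr, h⟩, fun h => h.2⟩
      by_cases h : r ∈ Set.Ioc 0 (radial e θ)
      · rw [Set.indicator_of_mem h, Set.indicator_of_mem (hiff.mpr h)]
        simp
      · rw [Set.indicator_of_notMem h, Set.indicator_of_notMem (fun h' => h (hiff.mp h'))]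
        simp
    have htm : MeasurableSet polarCoord.target := polarCoord.open_target.measurableSet
    have hgm : Measurable fun p : ℝ × ℝ =>
        (Set.Ioc 0 (radial e p.2)).indicator (fun r => ENNReal.ofReal r) p.1 := by
      have hs : MeasurableSet {p : ℝ × ℝ | p.1 ∈ Set.Ioc 0 (radial e p.2)} :=
        (measurableSet_lt measurable_const measurable_fst).inter
          (measurableSet_le measurable_fst ((continuous_radial e).measurable.comp measurable_snd))
      exact (ENNReal.measurable_ofReal.comp measurable_fst).indicator hs
    rw [setLIntegral_congr_fun htm hset, polarCoord_target, Measure.volume_eq_prod,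
      ← Measure.prod_restrict, lintegral_prod_symm _ hgm.aemeasurable]
    have hinner : ∀ θ, ∫⁻ r in Set.Ioi 0, (Set.Ioc 0 (radial e θ)).indicator
        (fun r => ENNReal.ofReal r) r = ENNReal.ofReal (radial e θ ^ 2 / 2) := by
      intro θ
      rw [lintegral_indicator measurableSet_Ioc, Measure.restrict_restrict measurableSet_Ioc,
        Set.inter_eq_left.mpr Set.Ioc_subset_Ioi_self,
        ← ofReal_integral_eq_lintegral_ofReal, ← intervalIntegral.integral_of_le
          (radial_pos e θ).le, integral_id]
      · simp
      · exact (continuous_id.integrableOn_Icc).mono_set Set.Ioc_subset_Icc_self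
      · exact (ae_restrict_mem measurableSet_Ioc).mono fun r hr => hr.1.le
    simp only [hinner]
    rw [← ofReal_integral_eq_lintegral_ofReal, ← integral_Ioc_eq_integral_Ioo,
      ← intervalIntegral.integral_of_le (by linarith [Real.pi_pos]), sector,
      intervalIntegral.integral_div]
    · exact ((((continuous_radial e).pow 2).div_const 2).integrableOn_Icc).mono_set
        Set.Ioo_subset_Icc_self
    · exact Filter.Eventually.of_forall fun r => by positivity
  rw [measureReal_def, hvol, ENNReal.toReal_ofReal]
  have := sector_nonneg e (a := -Real.pi) (b := Real.pi) (by linarith [Real.pi_pos])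
  positivity

theorem sector_period_eq (α : ℝ) :
    sector e α (α + 2 * Real.pi) = sector e (-Real.pi) Real.pi := by
  have hp : Function.Periodic (fun θ => radial e θ ^ 2) (2 * Real.pi) := fun θ => by
    simp only [radial_periodic e θ]
  have := hp.intervalIntegral_add_eq α (-Real.pi)
  rw [show -Real.pi + 2 * Real.pi = Real.pi by ring] at this
  exact this

open scoped Pointwise in
/-- The area of a parallelogram in terms of its diagonals. -/
theorem volume_real_parallelogram {p q r s : V} (h : p + r = q + s) :
    (volume : Measure ℂ).real (e ⁻¹' convexHull ℝ {p, q, r, s}) =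
      |areaForm e (r - p) (s - q)| / 2 := by
  set u : ℂ := e.symm (q - p) with hu
  set w : ℂ := e.symm (s - p) with hw
  have hr : r = q + s - p := by rw [← h]; abel
  have hset : e ⁻¹' convexHull ℝ {p, q, r, s} = e.symm p +ᵥ parallelepiped ![u, w] := by
    rw [parallelepiped_eq_convexHull, ← convexHull_vadd]
    have : (e ⁻¹' convexHull ℝ {p, q, r, s}) = e.symm '' convexHull ℝ {p, q, r, s} := by
      rw [← ContinuousLinearEquiv.image_symm_eq_preimage]
    rw [this]
    have h2 := (e.symm : V →ₗ[ℝ] ℂ).image_convexHull {p, q, r, s}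
    refine h2.trans ?_
    congr 1
    simp only [Fin.sum_univ_two, Matrix.cons_val_zero, Matrix.cons_val_one]
    ext z
    have e1 : e.symm q + e.symm s - e.symm p =
      e.symm p + (e.symm q - e.symm p + (e.symm s - e.symm p)) := by abel
    have e2 : ({0, u} + {0, w} : Set ℂ) = {0, u, w, u + w} := by
      simp only [Set.insert_eq, Set.union_add, Set.add_union, Set.singleton_add_singleton,
        zero_add, add_zero]
      ext z
      simp only [Set.mem_union, Set.mem_singleton_iff]
      tauto
    rw [e2]
    simp [Set.image_insert_eq, Set.vadd_set_insert, hr, hu, hw, e1]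
    tauto
  have hvol : (volume : Measure ℂ) (parallelepiped ![u, w]) =
      ENNReal.ofReal |Complex.basisOneI.det ![u, w]| := by
    have hb : Complex.basisOneI.addHaar = (volume : Measure ℂ) := by
      refine (Module.Basis.addHaar_eq_iff _ _).mpr ?_
      have := Complex.orthonormalBasisOneI.volume_parallelepiped
      simpa using this
    rw [← hb, Measure.addHaar_parallelepiped]
  rw [hset, measureReal_def, measure_vadd, hvol, ENNReal.toReal_ofReal (abs_nonneg _),
    Module.Basis.det_apply, Matrix.det_fin_two]
  simp only [Module.Basis.toMatrix_apply, Matrix.cons_val_zero, Matrix.cons_val_one]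
  -- The diagonals are the sum and difference of the sides, so they span twice the area.
  rw [eq_div_iff two_ne_zero, ← abs_two, ← abs_mul]
  congr 1
  simp [areaForm_apply, hr, hu, hw]
  ring

end Area

/-! ### The area of a maximal inscribed parallelogram. -/

section MaxParallelogram

variable {V : Type*} [NormedAddCommGroup V] [NormedSpace ℝ V] (e : ℂ ≃L[ℝ] V)

theorem abs_areaForm_le {p q r s : V} (hp : ‖p‖ = 1) (hq : ‖q‖ = 1) (hr : ‖r‖ = 1)
    (hs : ‖s‖ = 1) : |areaForm e (r - p) (s - q)| ≤ 4 * ‖areaForm e‖ := by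
  have h1 : ‖r - p‖ ≤ 2 := (norm_sub_le _ _).trans_eq (by rw [hp, hr]; norm_num)
  have h2 : ‖s - q‖ ≤ 2 := (norm_sub_le _ _).trans_eq (by rw [hs, hq]; norm_num)
  have hM := areaForm_norm_pos e
  calc |areaForm e (r - p) (s - q)| ≤ ‖areaForm e‖ * ‖r - p‖ * ‖s - q‖ :=
        (areaForm e).le_opNorm₂ _ _
    _ ≤ ‖areaForm e‖ * 2 * 2 := by gcongr
    _ = _ := by ring

theorem affineIndependent_neg_neg {x y : V} (h : areaForm e x y ≠ 0) :
    AffineIndependent ℝ ![-x, -y, x] := by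
  rw [affineIndependent_iff_not_collinear_set, collinear_iff_of_mem (p₀ := -x) (by simp)]
  rintro ⟨v, hv⟩
  obtain ⟨c, hc⟩ := hv (-y) (by simp)
  obtain ⟨d, hd⟩ := hv x (by simp)
  have h1 : x - y = c • v := by
    rw [vadd_eq_add] at hc
    rw [sub_eq_add_neg, hc]; abel
  have h2 : x + x = d • v := by
    rw [vadd_eq_add] at hd
    nth_rewrite 1 [hd]; abel
  have h3 : areaForm e (x + x) (x - y) = 0 := by
    rw [h1, h2]; simp
  simp at h3
  exact h (by linarith)

/-- The bound on diagonals needs no central symmetry; the symmetric parallelogram on a pair with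
A(x, y) = M attains it. -/
theorem measureReal_of_isMaxInscribedParallelogram [FiniteDimensional ℝ V] [Nontrivial V]
    [MeasurableSpace V] {μ : Measure V} [IsFiniteMeasureOnCompacts μ] {k : ℝ} (hk : 0 < k)
    (hμ : ∀ s : Set V, μ.real s = k * (volume : Measure ℂ).real (e ⁻¹' s))
    {P : Set V} (hP : IsMaxInscribedParallelogram μ P) :
    μ.real P = k * (2 * ‖areaForm e‖) := by
  obtain ⟨⟨p, q, r, s, hp, hq, hr, hs, hpr, -, rfl⟩, hmax⟩ := hP
  have hfin : μ (convexHull ℝ {p, q, r, s}) ≠ ⊤ :=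
    (((Set.toFinite {p, q, r, s}).isCompact_convexHull ℝ).measure_lt_top).ne
  refine le_antisymm ?_ ?_
  · rw [hμ, volume_real_parallelogram e hpr]
    have := abs_areaForm_le e (mem_sphere_zero_iff_norm.mp hp) (mem_sphere_zero_iff_norm.mp hq)
      (mem_sphere_zero_iff_norm.mp hr) (mem_sphere_zero_iff_norm.mp hs)
    gcongr
    linarith
  · obtain ⟨x, y, hx, hy, hxy⟩ := exists_areaForm_eq_norm e
    have hM := areaForm_norm_pos e
    have hQ : IsInscribedParallelogram (convexHull ℝ {-x, -y, x, y}) :=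
      ⟨-x, -y, x, y, by simpa, by simpa, by simpa, by simpa, by simp,
        affineIndependent_neg_neg e (by rw [hxy]; exact hM.ne'), rfl⟩
    have h1 : μ.real (convexHull ℝ {-x, -y, x, y}) = k * (2 * ‖areaForm e‖) := by
      rw [hμ, volume_real_parallelogram e (by simp)]
      have : areaForm e (x - -x) (y - -y) = 4 * ‖areaForm e‖ := by
        rw [← hxy]
        simp
        ring
      rw [this, abs_of_pos (by positivity)]
      ring
    rw [← h1]
    exact ENNReal.toReal_mono hfin (hmax _ hQ)

end MaxParallelogram

end MinkowskiPlane

theorem mainTheorem3 {V : Type*} [NormedAddCommGroup V] [NormedSpace ℝ V]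
    (hV : Module.finrank ℝ V = 2)
    [MeasurableSpace V] [BorelSpace V] (μ : Measure V) [μ.IsAddHaarMeasure]
    (P : Set V) (hP : MinkowskiPlane.IsMaxInscribedParallelogram μ P)
    (γ : ℝ → V) (a b : ℝ)
    (hγ : MinkowskiPlane.IsSimpleClosedParametrization γ a b (Metric.sphere (0 : V) 1)) :
    MinkowskiPlane.curveLength γ a b ≠ ⊤ ∧
    μ.real (Metric.closedBall (0 : V) 1) / μ.real P
        ≤ (MinkowskiPlane.curveLength γ a b).toReal / 4 ∧
    (μ.real (Metric.closedBall (0 : V) 1) / μ.real P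
        = (MinkowskiPlane.curveLength γ a b).toReal / 4 ↔
      MinkowskiPlane.UnitCircleIsRadon V) := by
  have : FiniteDimensional ℝ V := Module.finite_of_finrank_eq_succ hV
  have : Nontrivial V := Module.nontrivial_of_finrank_pos (R := ℝ) (by rw [hV]; norm_num)
  let e : ℂ ≃L[ℝ] V := ContinuousLinearEquiv.ofFinrankEq (by rw [hV, Complex.finrank_real_complex])
  obtain ⟨k, hk, hμ⟩ := MinkowskiPlane.exists_measureReal_eq e μ
  obtain ⟨α, hα⟩ := MinkowskiPlane.exists_curveLength_eq e hγ
  have hM := MinkowskiPlane.areaForm_norm_pos e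
  -- The Haar factor k cancels: the disc has measure k · sector / 2 and P has measure 2kM.
  have hratio : μ.real (Metric.closedBall (0 : V) 1) / μ.real P =
      MinkowskiPlane.sector e α (α + 2 * Real.pi) / ‖MinkowskiPlane.areaForm e‖ / 4 := by
    rw [MinkowskiPlane.measureReal_of_isMaxInscribedParallelogram e hk hμ hP, hμ,
      MinkowskiPlane.volume_real_unitDisc, MinkowskiPlane.sector_period_eq]
    field_simp
    norm_num
  rw [hratio, hα]
  refine ⟨MinkowskiPlane.eVariationOn_circ_ne_top e _ _, ?_, ?_⟩
  · gcongr
    rw [div_le_iff₀' hM]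
    exact MinkowskiPlane.sector_period_le e α
  · rw [div_left_inj' four_ne_zero, div_eq_iff hM.ne', mul_comm (ENNReal.toReal _)]
    exact MinkowskiPlane.sector_period_eq_iff_radon e α
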